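/- Let $n\ge 4$ be an even integer and $m=2n-1$. The helm graph $H_n$ has $m$ vertices: a hub, a cycle on $n-1$ vertices all of which are adjacent to the hub, and $n-1$ pendant vertices, one attached to each vertex of the cycle. Let $D$ be the distance matrix of $H_n$, that is, $D_{vw}$ is the length of a shortest path from $v$ to $w$. Let $I$ be the identity matrix of order $n-1$ and $\mathbf 1$ the all-ones vector in $\mathbb{R}^{n-1}$. For $s\in\mathbb{R}^{n-1}$, let $\mathrm{Circ}(s')$ be the circulant matrix of order $n-1$ with first row $s'$, each row being the previous one shifted cyclically one place to the right. For $1\le k\le \frac n2-1$ let $C_k=\mathrm{Circ}({c^k}')$, where $c^k\in\mathbb{R}^{n-1}$ has entries $c^k_j=1$ for $j=k+1$ and $j=n-k$, and $c^k_j=0$ otherwise. Ordering the vertices as hub, cycle vertices in cyclic order, and pendant vertices in the corresponding order, define the special Laplacian matrix of $H_n$ by $$\mathcal L=\frac12\begin{bmatrix} n-1 & -\mathbf 1' & 0\\ -\mathbf 1 & (n+1)I & -2I\\ 0 & -2I & 2I\end{bmatrix}+\sum_{k=1}^{\frac n2-1}(-1)^k\,\frac{(n-1)-2k}{2}\begin{bmatrix}0&0&0\\0&C_k&0\\0&0&0\end{bmatrix}.$$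 **Theorem (interlacing between the eigenvalues of $\mathcal L$ and $D$).** Let $\mu_1\ge\mu_2\ge\cdots\ge\mu_m$ and $\lambda_1\ge\lambda_2\ge\cdots\ge\lambda_m$ be the eigenvalues of $D$ and of $\mathcal L$, respectively, listed with multiplicity. Then $\mu_1>0>\mu_2$ and $\lambda_{m-1}>\lambda_m=0$, and $$0>-\frac{2}{\lambda_1}\ge\mu_2\ge-\frac{2}{\lambda_2}\ge\mu_3\ge\cdots\ge-\frac{2}{\lambda_{m-1}}\ge\mu_m .$$ -/

import Mathlib

/-- The vertices of the helm graph `H_n`: the hub, the `n - 1` vertices of the outer cycle of the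
wheel `W_n`, and the `n - 1` pendant vertices. -/
abbrev HelmVertex (n : ℕ) : Type := Unit ⊕ (Fin (n - 1) ⊕ Fin (n - 1))

/-- The helm graph `H_n`: the hub is joined to each vertex of the cycle on `n - 1` vertices, and
one pendant vertex is attached to each vertex of the cycle. -/
def helmGraph (n : ℕ) : SimpleGraph (HelmVertex n) where
  Adj
    | .inl _, .inr (.inl _) => True
    | .inr (.inl _), .inl _ => True
    | .inr (.inl i), .inr (.inl j) => (SimpleGraph.cycleGraph (n - 1)).Adj i j
    | .inr (.inl i), .inr (.inr j) => i = j
    | .inr (.inr i), .inr (.inl j) => i = j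
    | _, _ => False
  symm := ⟨by
    rintro (_ | i | i) (_ | j | j) h
    · exact h
    · exact h
    · exact h
    · exact h
    · exact SimpleGraph.Adj.symm h
    · exact Eq.symm h
    · exact h
    · exact Eq.symm h
    · exact h⟩
  loopless := ⟨by
    rintro (_ | i | i) h
    · exact h
    · exact SimpleGraph.irrefl _ h
    · exact h⟩

/-- The distance matrix of `H_n`. -/
noncomputable def helmDist (n : ℕ) : Matrix (HelmVertex n) (HelmVertex n) ℝ :=
  Matrix.of fun v w => ((helmGraph n).dist v w : ℝ)

/-- The circulant matrix with first row `s`; each row is the previous one moved cyclically one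
place to the right (the differences of indices are taken modulo `μ`). -/
def circ {μ : ℕ} (s : Fin μ → ℝ) : Matrix (Fin μ) (Fin μ) ℝ :=
  Matrix.of fun i j => s (j - i)

/-- The vector `c^k` in `ℝ^(n-1)`: in terms of positions `1, …, n - 1`, it has entry `1` at the
positions `k + 1` and `n - k`, and `0` elsewhere (here `j` counts from `0`). -/
def cVec (n k : ℕ) : Fin (n - 1) → ℝ :=
  fun j => if (j : ℕ) + 1 = k + 1 ∨ (j : ℕ) + 1 = n - k then 1 else 0

/-- The special Laplacian matrix of `H_n`, for even `n`. -/
noncomputable def helmLaplacian (n : ℕ) : Matrix (HelmVertex n) (HelmVertex n) ℝ :=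
  (1 / 2 : ℝ) •
    Matrix.fromBlocks
      (Matrix.of fun _ _ => (n : ℝ) - 1)
      (Matrix.fromCols (Matrix.of fun _ _ => (-1 : ℝ)) 0)
      (Matrix.fromRows (Matrix.of fun _ _ => (-1 : ℝ)) 0)
      (Matrix.fromBlocks (((n : ℝ) + 1) • 1) ((-2 : ℝ) • 1) ((-2 : ℝ) • 1) ((2 : ℝ) • 1))
  + ∑ k ∈ Finset.Icc 1 (n / 2 - 1), ((-1 : ℝ) ^ k * (((n : ℝ) - 1 - 2 * (k : ℝ)) / 2)) •
      Matrix.fromBlocks 0 0 0 (Matrix.fromBlocks (circ (cVec n k)) 0 0 0)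

open Matrix

/-! Write `N = n - 1 = 2p + 1` for the length of the cycle. Everything rests on a Graham–Lovász type
formula `D⁻¹ = -L/2 + c y yᵀ` with `c = 1/(3N) > 0` and `y = helmVec p`
(`helm_inverse_mul_helmDist`). A positive rank-one term moves each eigenvalue of `-L/2` up, at most
to the next one, so the numbers `1/μ` and `-λ/2` interlace; inverting gives the claim
(`interlacing_of_inverse_eq`).

The formula comes from the cycle. Since `N` is odd, its signless Laplacian `S` is invertible, and `A
= 2 S⁻¹` is an explicit circulant (`cycleAlt_mul_cycleSignless`). The blocks of `D` are affine in
`S`, while the cycle block of `L` is `I + A`, so `L D` collapses to `y 1ᵀ - 2 I`. As `A` is positive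
definite, `L` is positive semidefinite with kernel of dimension one (`helmLaplacian_quadratic`). -/

/-! ### Ordered eigenbases, dimension counts and Rayleigh bounds. -/

/-- Two functions on a finite type with the same multiset of values differ by a permutation. -/
theorem exists_perm_eq_comp_of_map_univ_eq {V α : Type*} [Fintype V] (f g : V → α)
    (h : Finset.univ.val.map f = Finset.univ.val.map g) : ∃ σ : Equiv.Perm V, f = g ∘ σ := by
  classical
  have key : ∀ c, Nonempty ({v // f v = c} ≃ {v // g v = c}) := by
    intro c
    refine ⟨Fintype.equivOfCardEq ?_⟩
    have h1 := congrArg (Multiset.count c) h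
    rw [Multiset.count_map, Multiset.count_map] at h1
    rw [Fintype.card_subtype, Fintype.card_subtype, Finset.card_def, Finset.card_def,
      Finset.filter_val, Finset.filter_val]
    simpa only [eq_comm] using h1
  let e := fun c => Classical.choice (key c)
  refine ⟨(Equiv.sigmaFiberEquiv f).symm.trans
    ((Equiv.sigmaCongrRight e).trans (Equiv.sigmaFiberEquiv g)), funext fun v => ?_⟩
  exact (e (f v) ⟨v, rfl⟩).2.symm

/-- A real symmetric matrix whose characteristic polynomial splits with roots `mu 1, …, mu m` has
an orthonormal family of eigenvectors with the eigenvalues in this order. -/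
theorem exists_orthonormal_eigenvectors {V : Type*} [Fintype V] [DecidableEq V]
    (A : Matrix V V ℝ) (hA : A.IsSymm) (m : ℕ) (mu : ℕ → ℝ)
    (h : A.charpoly = ∏ i ∈ Finset.Icc 1 m, (Polynomial.X - Polynomial.C (mu i))) :
    ∃ b : ℕ → V → ℝ, (∀ i ∈ Finset.Icc 1 m, b i ≠ 0) ∧
      (∀ i ∈ Finset.Icc 1 m, A *ᵥ b i = mu i • b i) ∧
      ∀ x z : V → ℝ, x ⬝ᵥ z = ∑ i ∈ Finset.Icc 1 m, (b i ⬝ᵥ x) * (b i ⬝ᵥ z) := by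
  have hH : A.IsHermitian := by
    rw [Matrix.IsHermitian, Matrix.conjTranspose_eq_transpose_of_trivial]; exact hA
  have hcard : Fintype.card V = Fintype.card (Finset.Icc 1 m) := by
    have h1 := congrArg Polynomial.natDegree h
    rw [Matrix.charpoly_natDegree_eq_dim, Polynomial.natDegree_prod_of_monic _ _
      (fun i _ => Polynomial.monic_X_sub_C _)] at h1
    simpa using h1
  let e : V ≃ Finset.Icc 1 m := Fintype.equivOfCardEq hcard
  have hroots : Finset.univ.val.map hH.eigenvalues
      = Finset.univ.val.map (fun v => mu (e v)) := by
    have h2 := hH.charpoly_eq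
    rw [h] at h2
    have h3 : ∏ i ∈ Finset.Icc 1 m, (Polynomial.X - Polynomial.C (mu i))
        = ∏ v : V, (Polynomial.X - Polynomial.C (mu (e v))) := by
      rw [← Finset.prod_coe_sort]
      exact (Equiv.prod_comp e (fun i => (Polynomial.X - Polynomial.C (mu i)))).symm
    rw [h3] at h2
    have h4 := congrArg Polynomial.roots h2
    have key : ∀ f : V → ℝ, (∏ v : V, (Polynomial.X - Polynomial.C (f v))).roots
        = Finset.univ.val.map f := by
      intro f
      rw [Polynomial.roots_prod _ _ (Finset.prod_ne_zero_iff.2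
        (fun v _ => Polynomial.X_sub_C_ne_zero _))]
      simp
    have h5 := key (fun v => mu (e v))
    have h6 := key hH.eigenvalues
    rw [← h5, ← h6, h4]
    rfl
  obtain ⟨σ, hσ⟩ := exists_perm_eq_comp_of_map_univ_eq _ _ hroots
  let g : V ≃ Finset.Icc 1 m := σ.trans e
  refine ⟨fun i => if hi : i ∈ Finset.Icc 1 m then
    (hH.eigenvectorBasis (g.symm ⟨i, hi⟩) : EuclideanSpace ℝ V).ofLp else 0, ?_, ?_, ?_⟩
  · intro i hi
    simp only [hi, dif_pos]
    intro h0
    have h9 := hH.eigenvectorBasis.orthonormal.ne_zero (g.symm ⟨i, hi⟩)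
    exact h9 ((WithLp.ofLp_eq_zero 2).1 h0)
  · intro i hi
    simp only [hi, dif_pos]
    rw [hH.mulVec_eigenvectorBasis]
    have h7 : hH.eigenvalues (g.symm ⟨i, hi⟩) = mu i := by
      rw [hσ]
      have : e (σ (g.symm ⟨i, hi⟩)) = ⟨i, hi⟩ := g.apply_symm_apply ⟨i, hi⟩
      simp [Function.comp, this]
    rw [h7]
  · intro x z
    have h8 := hH.eigenvectorBasis.sum_inner_mul_inner (WithLp.toLp 2 x) (WithLp.toLp 2 z)
    rw [← Finset.sum_coe_sort]
    rw [← Equiv.sum_comp g]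
    simp only [EuclideanSpace.inner_eq_star_dotProduct, star_trivial] at h8
    rw [dotProduct_comm, ← h8]
    refine Finset.sum_congr rfl fun v _ => ?_
    simp [dotProduct_comm]

/-- Fewer linear conditions than the dimension leave a nonzero solution. -/
theorem exists_ne_zero_forall_dotProduct_eq_zero {V : Type*} [Fintype V]
    (b l : ℕ → V → ℝ) (Y : Finset (V → ℝ)) (S T : Finset ℕ) (h : S.card + T.card + Y.card < Fintype.card V) :
    ∃ x : V → ℝ, x ≠ 0 ∧ (∀ i ∈ S, b i ⬝ᵥ x = 0) ∧ (∀ i ∈ T, l i ⬝ᵥ x = 0) ∧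
      ∀ y ∈ Y, y ⬝ᵥ x = 0 := by
  let M : Matrix (S ⊕ T ⊕ Y) V ℝ :=
    Matrix.of (Sum.elim (fun i => b i) (Sum.elim (fun i => l i) (fun y => y)))
  have hk : LinearMap.ker M.mulVecLin ≠ ⊥ := by
    apply LinearMap.ker_ne_bot_of_finrank_lt
    simp
    omega
  obtain ⟨x, hx, hx0⟩ := (Submodule.ne_bot_iff _).1 hk
  have hM : M *ᵥ x = 0 := by simpa using hx
  refine ⟨x, hx0, fun i hi => ?_, fun i hi => ?_, fun i hi => ?_⟩
  · exact congrFun hM (Sum.inl ⟨i, hi⟩)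
  · exact congrFun hM (Sum.inr (Sum.inl ⟨i, hi⟩))
  · exact congrFun hM (Sum.inr (Sum.inr ⟨i, hi⟩))

/-- Diagonalisation of a quadratic form in a resolution of the identity. -/
theorem dotProduct_mulVec_eq_sum {V : Type*} [Fintype V] (A : Matrix V V ℝ) (hA : A.IsSymm)
    (s : Finset ℕ) (mu : ℕ → ℝ) (b : ℕ → V → ℝ) (hb : ∀ i ∈ s, A *ᵥ b i = mu i • b i)
    (hs : ∀ x z : V → ℝ, x ⬝ᵥ z = ∑ i ∈ s, (b i ⬝ᵥ x) * (b i ⬝ᵥ z)) (x : V → ℝ) :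
    x ⬝ᵥ A *ᵥ x = ∑ i ∈ s, mu i * (b i ⬝ᵥ x) ^ 2 := by
  rw [hs]
  refine Finset.sum_congr rfl fun i hi => ?_
  rw [dotProduct_mulVec (b i) A x, ← mulVec_transpose, hA.eq, hb i hi, smul_dotProduct, smul_eq_mul]
  ring

/-- Half of the Courant–Fischer principle: the disjunction says that `x` has components only along
eigenvectors whose eigenvalue is at most `c`. The next lemma is the other half. -/
theorem dotProduct_mulVec_le {V : Type*} [Fintype V] (A : Matrix V V ℝ) (hA : A.IsSymm)
    (s : Finset ℕ) (mu : ℕ → ℝ) (b : ℕ → V → ℝ) (hb : ∀ i ∈ s, A *ᵥ b i = mu i • b i)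
    (hs : ∀ x z : V → ℝ, x ⬝ᵥ z = ∑ i ∈ s, (b i ⬝ᵥ x) * (b i ⬝ᵥ z)) (x : V → ℝ) (c : ℝ)
    (h : ∀ i ∈ s, b i ⬝ᵥ x = 0 ∨ mu i ≤ c) : x ⬝ᵥ A *ᵥ x ≤ c * (x ⬝ᵥ x) := by
  rw [dotProduct_mulVec_eq_sum A hA s mu b hb hs, hs x x, Finset.mul_sum]
  refine Finset.sum_le_sum fun i hi => ?_
  rcases h i hi with h | h
  · simp [h]
  · rw [← pow_two]; exact mul_le_mul_of_nonneg_right h (sq_nonneg _)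

theorem le_dotProduct_mulVec {V : Type*} [Fintype V] (A : Matrix V V ℝ) (hA : A.IsSymm)
    (s : Finset ℕ) (mu : ℕ → ℝ) (b : ℕ → V → ℝ) (hb : ∀ i ∈ s, A *ᵥ b i = mu i • b i)
    (hs : ∀ x z : V → ℝ, x ⬝ᵥ z = ∑ i ∈ s, (b i ⬝ᵥ x) * (b i ⬝ᵥ z)) (x : V → ℝ) (c : ℝ)
    (h : ∀ i ∈ s, b i ⬝ᵥ x = 0 ∨ c ≤ mu i) : c * (x ⬝ᵥ x) ≤ x ⬝ᵥ A *ᵥ x := by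
  rw [dotProduct_mulVec_eq_sum A hA s mu b hb hs, hs x x, Finset.mul_sum]
  refine Finset.sum_le_sum fun i hi => ?_
  rcases h i hi with h | h
  · simp [h]
  · rw [← pow_two]; exact mul_le_mul_of_nonneg_right h (sq_nonneg _)

/-! ### Interlacing for a rank-one perturbation of the inverse. -/

/-- Eigenvalue interlacing for an invertible symmetric matrix `D` whose inverse is a positive
rank-one perturbation of `-L / 2`, where `L` is positive semidefinite with nullity one. -/
theorem interlacing_of_inverse_eq {V : Type*} [Fintype V] [DecidableEq V]
    (D L : Matrix V V ℝ) (y : V → ℝ) (c : ℝ) (hc : 0 ≤ c) (o : V)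
    (hD : D.IsSymm) (hL : L.IsSymm)
    (hinv : (-(1 / 2 : ℝ) • L + c • vecMulVec y y) * D = 1)
    (hpos : ∀ x, 0 ≤ x ⬝ᵥ L *ᵥ x)
    (hker : ∀ x, x ⬝ᵥ L *ᵥ x = 0 → x o = 0 → x = 0)
    (hL1 : ∃ x, x ≠ 0 ∧ L *ᵥ x = 0) (hDpos : ∃ x, 0 < x ⬝ᵥ D *ᵥ x)
    (m : ℕ) (hm : 2 ≤ m) (mu lam : ℕ → ℝ)
    (hmu : AntitoneOn mu (Set.Icc 1 m))
    (hmuD : D.charpoly = ∏ i ∈ Finset.Icc 1 m, (Polynomial.X - Polynomial.C (mu i)))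
    (hlam : AntitoneOn lam (Set.Icc 1 m))
    (hlamL : L.charpoly = ∏ i ∈ Finset.Icc 1 m, (Polynomial.X - Polynomial.C (lam i))) :
    (0 < mu 1 ∧ mu 2 < 0) ∧
    (0 < lam (m - 1) ∧ lam m = 0) ∧
    -2 / lam 1 < 0 ∧
    (∀ k ∈ Finset.Icc 1 (m - 1), mu (k + 1) ≤ -2 / lam k) ∧
    (∀ k ∈ Finset.Icc 2 (m - 1), -2 / lam k ≤ mu k) := by
  have hcard : Fintype.card V = m := by
    have h1 := congrArg Polynomial.natDegree hmuD
    rw [Matrix.charpoly_natDegree_eq_dim, Polynomial.natDegree_prod_of_monic _ _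
      (fun i _ => Polynomial.monic_X_sub_C _)] at h1
    simpa using h1
  have hmu' : ∀ i j, 1 ≤ i → i ≤ j → j ≤ m → mu j ≤ mu i := fun i j h1 h2 h3 =>
    hmu ⟨h1, h2.trans h3⟩ ⟨h1.trans h2, h3⟩ h2
  have hlam' : ∀ i j, 1 ≤ i → i ≤ j → j ≤ m → lam j ≤ lam i := fun i j h1 h2 h3 =>
    hlam ⟨h1, h2.trans h3⟩ ⟨h1.trans h2, h3⟩ h2
  obtain ⟨b, hb0, hb, hbs⟩ := exists_orthonormal_eigenvectors D hD m mu hmuD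
  obtain ⟨l, hl0, hl, hls⟩ := exists_orthonormal_eigenvectors L hL m lam hlamL
  set M := -(1 / 2 : ℝ) • L + c • vecMulVec y y with hMdef
  have hM : M.IsSymm := by
    ext i j
    have := congrFun (congrFun hL.eq i) j
    simp only [Matrix.transpose_apply] at this
    simp [hMdef, vecMulVec_apply, this, mul_comm]
  have hMq : ∀ x, x ⬝ᵥ M *ᵥ x = -(1 / 2) * (x ⬝ᵥ L *ᵥ x) + c * (y ⬝ᵥ x) ^ 2 := by
    intro x
    rw [hMdef, add_mulVec, smul_mulVec, smul_mulVec, dotProduct_add, dotProduct_smul,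
      dotProduct_smul, vecMulVec_mulVec]
    rw [op_smul_eq_smul, dotProduct_smul, dotProduct_comm x y]
    simp only [smul_eq_mul]
    ring
  have hbinv : ∀ i ∈ Finset.Icc 1 m, mu i • (M *ᵥ b i) = b i := by
    intro i hi
    rw [← mulVec_smul, ← hb i hi, mulVec_mulVec, hinv, one_mulVec]
  have hpp : ∀ x : V → ℝ, x ≠ 0 → 0 < x ⬝ᵥ x := by
    intro x hx
    have h0 : 0 ≤ x ⬝ᵥ x := Finset.sum_nonneg fun i _ => mul_self_nonneg _
    exact lt_of_le_of_ne h0 (fun h => hx (dotProduct_self_eq_zero.1 h.symm))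
  have hmu0 : ∀ i ∈ Finset.Icc 1 m, mu i ≠ 0 := by
    intro i hi h0
    have := hbinv i hi
    rw [h0, zero_smul] at this
    exact hb0 i hi this.symm
  have hbM : ∀ i ∈ Finset.Icc 1 m, M *ᵥ b i = (mu i)⁻¹ • b i := by
    intro i hi
    conv_rhs => rw [← hbinv i hi]
    rw [smul_smul, inv_mul_cancel₀ (hmu0 i hi), one_smul]
  have hmu1 : 0 < mu 1 := by
    by_contra! hneg
    obtain ⟨x, hx⟩ := hDpos
    have := dotProduct_mulVec_le D hD _ mu b hb hbs x 0 (fun i hi => Or.inr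
      ((hmu' 1 i le_rfl (Finset.mem_Icc.1 hi).1 (Finset.mem_Icc.1 hi).2).trans hneg))
    linarith
  -- If `mu 2` were positive, the form of `M = D⁻¹` would be positive on the span of `b 1` and `b
  -- 2`; but that plane meets the hyperplane orthogonal to `y`, where the form is `-L/2 ≤ 0`.
  have hmu2 : mu 2 < 0 := by
    by_contra! hneg
    have hmupos : 0 < mu 2 := lt_of_le_of_ne hneg (hmu0 2 (by simp; omega)).symm
    obtain ⟨x, hx0, hx1, -, hx2⟩ := exists_ne_zero_forall_dotProduct_eq_zero b l {y} (Finset.Icc 3 m) ∅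
      (by simp; omega)
    have h1 := le_dotProduct_mulVec M hM _ _ b hbM hbs x (mu 1)⁻¹ (by
      intro i hi
      rw [Finset.mem_Icc] at hi
      by_cases h3 : 3 ≤ i
      · exact Or.inl (hx1 i (by simp; omega))
      · refine Or.inr (inv_anti₀ ?_ (hmu' 1 i le_rfl hi.1 hi.2))
        exact hmupos.trans_le (hmu' i 2 hi.1 (by omega) hm))
    rw [hMq, hx2 y (by simp)] at h1
    have h2 := mul_pos (inv_pos.2 hmu1) (hpp x hx0)
    have h3 := hpos x
    linarith
  have hmuneg : ∀ i, 2 ≤ i → i ≤ m → mu i < 0 := fun i h1 h2 =>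
    (hmu' 2 i (by omega) h1 h2).trans_lt hmu2
  have hlam1 : 0 < lam (m - 1) := by
    by_contra! hneg
    -- Orthogonality to `Pi.single o 1` encodes `x o = 0`, the condition under which `hker` makes
    -- the form of `L` definite.
    obtain ⟨x, hx0, -, hx1, hx2'⟩ := exists_ne_zero_forall_dotProduct_eq_zero b l {Pi.single o 1} ∅
      (Finset.Icc 1 (m - 2)) (by simp; omega)
    have h1 := dotProduct_mulVec_le L hL _ _ l hl hls x 0 (by
      intro i hi
      rw [Finset.mem_Icc] at hi
      by_cases h3 : i ≤ m - 2
      · exact Or.inl (hx1 i (by simp; omega))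
      · exact Or.inr ((hlam' (m - 1) i (by omega) (by omega) hi.2).trans hneg))
    refine hx0 (hker x (le_antisymm (by linarith) (hpos x)) ?_)
    simpa using hx2'
  have hlampos : ∀ k ∈ Finset.Icc 1 (m - 1), 0 < lam k := by
    intro k hk
    rw [Finset.mem_Icc] at hk
    exact hlam1.trans_le (hlam' k (m - 1) hk.1 hk.2 (by omega))
  have hlamm : lam m = 0 := by
    apply le_antisymm
    · by_contra! hneg
      obtain ⟨x, hx0, hx⟩ := hL1
      have h1 := le_dotProduct_mulVec L hL _ _ l hl hls x (lam m) (fun i hi => Or.inr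
        (hlam' i m (Finset.mem_Icc.1 hi).1 (Finset.mem_Icc.1 hi).2 le_rfl))
      rw [hx, dotProduct_zero] at h1
      have := mul_pos hneg (hpp x hx0)
      linarith
    · by_contra! hneg
      have hmm : m ∈ Finset.Icc 1 m := by simp; omega
      have h1 := hpos (l m)
      rw [hl m hmm, dotProduct_smul, smul_eq_mul] at h1
      have := mul_neg_of_neg_of_pos hneg (hpp _ (hl0 m hmm))
      linarith
  refine ⟨⟨hmu1, hmu2⟩, ⟨hlam1, hlamm⟩, ?_, ?_, ?_⟩
  · have := hlampos 1 (by simp; omega)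
    exact div_neg_of_neg_of_pos (by norm_num) this
  · intro k hk
    have hlk := hlampos k hk
    rw [Finset.mem_Icc] at hk
    have hmk := hmuneg (k + 1) (by omega) (by omega)
    -- Take `x` in the span of `b 2, …, b (k + 1)` and orthogonal to `l 1, …, l (k - 1)`: these are
    -- `m - 1` conditions. The rank-one term is nonnegative, so it helps here and `y` costs no
    -- condition.
    have key : -(1 / 2) * lam k ≤ (mu (k + 1))⁻¹ := by
      by_contra! hlt
      obtain ⟨x, hx0, hx1, hx2, -⟩ := exists_ne_zero_forall_dotProduct_eq_zero b l ∅
        (insert 1 (Finset.Icc (k + 2) m)) (Finset.Icc 1 (k - 1)) (by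
          rw [Finset.card_insert_of_notMem (by simp)]; simp; omega)
      have h1 := dotProduct_mulVec_le M hM _ _ b hbM hbs x (mu (k + 1))⁻¹ (by
        intro i hi
        rw [Finset.mem_Icc] at hi
        by_cases h1 : i = 1 ∨ k + 2 ≤ i
        · exact Or.inl (hx1 i (by simp; omega))
        · exact Or.inr ((inv_le_inv_of_neg (hmuneg i (by omega) hi.2) hmk).2
            (hmu' i (k + 1) (by omega) (by omega) (by omega))))
      have h2 := dotProduct_mulVec_le L hL _ _ l hl hls x (lam k) (by
        intro i hi
        rw [Finset.mem_Icc] at hi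
        by_cases h3 : i ≤ k - 1
        · exact Or.inl (hx2 i (by simp; omega))
        · exact Or.inr (hlam' k i hk.1 (by omega) hi.2))
      rw [hMq] at h1
      have h3 := mul_lt_mul_of_pos_right hlt (hpp x hx0)
      have h4 := mul_nonneg hc (sq_nonneg (y ⬝ᵥ x))
      linarith
    rw [le_div_iff₀ hlk]
    have := mul_le_mul_of_nonpos_left key hmk.le
    rw [mul_inv_cancel₀ hmk.ne] at this
    linarith
  · intro k hk
    rw [Finset.mem_Icc] at hk
    have hlk := hlampos k (by simp; omega)
    have hmk := hmuneg k (by omega) (by omega)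
    -- Here the rank-one term has the wrong sign and is killed by `y ⬝ᵥ x = 0`. The index `1` needs
    -- no condition, because `(mu 1)⁻¹` is positive; the total is again `m - 1`.
    have key : (mu k)⁻¹ ≤ -(1 / 2) * lam k := by
      by_contra! hlt
      obtain ⟨x, hx0, hx1, hx2, hx3⟩ := exists_ne_zero_forall_dotProduct_eq_zero b l {y}
        (Finset.Icc 2 (k - 1)) (Finset.Icc (k + 1) m) (by simp; omega)
      have h1 := le_dotProduct_mulVec M hM _ _ b hbM hbs x (mu k)⁻¹ (by
        intro i hi
        rw [Finset.mem_Icc] at hi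
        by_cases h1 : i = 1
        · subst h1
          exact Or.inr ((inv_lt_zero.2 hmk).le.trans (inv_pos.2 hmu1).le)
        by_cases h3 : i ≤ k - 1
        · exact Or.inl (hx1 i (by simp; omega))
        · refine Or.inr ((inv_le_inv_of_neg hmk (hmuneg i (by omega) hi.2)).2
            (hmu' k i (by omega) (by omega) hi.2)))
      have h2 := le_dotProduct_mulVec L hL _ _ l hl hls x (lam k) (by
        intro i hi
        rw [Finset.mem_Icc] at hi
        by_cases h3 : i ≤ k
        · exact Or.inr (hlam' i k hi.1 h3 (by omega))
        · exact Or.inl (hx2 i (by simp; omega)))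
      rw [hMq, hx3 y (by simp)] at h1
      have := mul_lt_mul_of_pos_right hlt (hpp x hx0)
      linarith
    rw [div_le_iff₀ hlk]
    have := mul_le_mul_of_nonpos_left key hmk.le
    rw [mul_inv_cancel₀ hmk.ne] at this
    linarith

/-! ### Distances in the helm graph. -/

/-- A function satisfying the local rules of the distance from a vertex is the distance. -/
theorem SimpleGraph.dist_eq_of_local {V : Type*} (G : SimpleGraph V) (v : V) (f : V → ℕ)
    (h0 : f v = 0) (hv : ∀ w, f w = 0 → w = v)
    (hle : ∀ w w', G.Adj w w' → f w ≤ f w' + 1)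
    (hstep : ∀ w, f w ≠ 0 → ∃ w', G.Adj w' w ∧ f w' + 1 = f w) (w : V) :
    G.dist v w = f w := by
  -- Descending along `f` one unit at a time reaches `v`; this bounds the distance above, and `hlow`
  -- bounds it below.
  have hwalk : ∀ k w, f w = k → ∃ p : G.Walk v w, p.length = k := by
    intro k
    induction k with
    | zero =>
      intro w hw
      obtain rfl := hv w hw
      exact ⟨SimpleGraph.Walk.nil, rfl⟩
    | succ k ih =>
      intro w hw
      obtain ⟨w', ha, hw'⟩ := hstep w (by omega)
      obtain ⟨p, hp⟩ := ih w' (by omega)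
      exact ⟨p.concat ha, by rw [SimpleGraph.Walk.length_concat, hp]⟩
  have hlow : ∀ u (p : G.Walk u w), f w ≤ f u + p.length := by
    intro u p
    induction p with
    | nil => simp
    | cons ha q ih =>
      have := hle _ _ ha.symm
      rw [SimpleGraph.Walk.length_cons]
      omega
  obtain ⟨p, hp⟩ := hwalk _ w rfl
  apply le_antisymm
  · exact hp ▸ SimpleGraph.dist_le p
  · obtain ⟨q, hq⟩ := (SimpleGraph.Walk.reachable p).exists_walk_length_eq_dist
    have := hlow v q
    omega

open Classical in
/-- The distance within a helm graph between two vertices of its cycle. -/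
noncomputable def helmCycleDist (N : ℕ) (i j : Fin N) : ℕ :=
  if i = j then 0 else if (SimpleGraph.cycleGraph N).Adj i j then 1 else 2

/-- The distance within a helm graph. -/
noncomputable def helmDistFun (n : ℕ) : HelmVertex n → HelmVertex n → ℕ
  | .inl _, .inl _ => 0
  | .inl _, .inr (.inl _) => 1
  | .inl _, .inr (.inr _) => 2
  | .inr (.inl _), .inl _ => 1
  | .inr (.inr _), .inl _ => 2
  | .inr (.inl i), .inr (.inl j) => helmCycleDist (n - 1) i j
  | .inr (.inl i), .inr (.inr j) => helmCycleDist (n - 1) i j + 1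
  | .inr (.inr i), .inr (.inl j) => helmCycleDist (n - 1) i j + 1
  | .inr (.inr i), .inr (.inr j) => if i = j then 0 else helmCycleDist (n - 1) i j + 2

theorem helmCycleDist_eq_zero (N : ℕ) (i j : Fin N) : helmCycleDist N i j = 0 ↔ i = j := by
  unfold helmCycleDist
  split_ifs <;> simp_all

theorem helmCycleDist_le_two (N : ℕ) (i j : Fin N) : helmCycleDist N i j ≤ 2 := by
  unfold helmCycleDist
  split_ifs <;> simp_all

theorem helmCycleDist_le_of_adj (N : ℕ) (i j k : Fin N)
    (h : (SimpleGraph.cycleGraph N).Adj j k) :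
    helmCycleDist N i j ≤ helmCycleDist N i k + 1 := by
  unfold helmCycleDist
  split_ifs <;> simp_all [SimpleGraph.adj_comm]

/-- The hub brings any two cycle vertices within distance two, and a pendant vertex is left only
through its stem. -/
theorem helmGraph_dist (n : ℕ) (v w : HelmVertex n) :
    (helmGraph n).dist v w = helmDistFun n v w := by
  apply SimpleGraph.dist_eq_of_local
  · rcases v with _ | i | i <;> simp [helmDistFun, helmCycleDist_eq_zero]
  · rcases v with _ | i | i <;> rintro (_ | j | j) h <;>
      simp_all [helmDistFun, helmCycleDist_eq_zero]
  · intro a b h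
    rcases v with _ | i | i <;> rcases a with _ | j | j <;> rcases b with _ | k | k <;>
      simp only [helmGraph] at h <;> simp only [helmDistFun]
    all_goals try omega
    all_goals try have := helmCycleDist_le_of_adj (n - 1) i j k h
    all_goals try have := helmCycleDist_le_two (n - 1) i j
    all_goals try split_ifs
    all_goals try subst h
    all_goals try omega
    all_goals simp_all [helmCycleDist_eq_zero]
  · rintro a ha
    rcases v with _ | i | i <;> rcases a with _ | j | j <;> simp only [helmDistFun] at ha ⊢
    · exact absurd rfl ha
    · exact ⟨.inl (), trivial, rfl⟩
    · exact ⟨.inr (.inl j), rfl, rfl⟩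
    · exact ⟨.inr (.inl i), trivial, by simp [helmCycleDist_eq_zero]⟩
    · by_cases hij : (SimpleGraph.cycleGraph (n - 1)).Adj i j
      · exact ⟨.inr (.inl i), hij, by simp [helmCycleDist, hij, hij.ne]⟩
      · refine ⟨.inl (), trivial, ?_⟩
        have := mt (helmCycleDist_eq_zero (n - 1) i j).2 ha
        simp [helmCycleDist, hij, this]
    · exact ⟨.inr (.inl j), rfl, rfl⟩
    · exact ⟨.inr (.inl i), trivial, by simp [(helmCycleDist_eq_zero (n - 1) i i).2 rfl]⟩
    · by_cases hij : i = j
      · subst hij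
        exact ⟨.inr (.inr i), rfl, by simp [(helmCycleDist_eq_zero (n - 1) i i).2 rfl]⟩
      · by_cases hadj : (SimpleGraph.cycleGraph (n - 1)).Adj i j
        · exact ⟨.inr (.inl i), hadj, by simp [helmCycleDist, hadj, hadj.ne]⟩
        · exact ⟨.inl (), trivial, by simp [helmCycleDist, hij, hadj]⟩
    · refine ⟨.inr (.inl j), rfl, ?_⟩
      have hij : i ≠ j := by
        rintro rfl
        exact ha (if_pos rfl)
      simp [hij]

/-! ### The signless Laplacian of an odd cycle and its inverse. -/

/-- The coefficients of twice the inverse of the signless Laplacian of an odd cycle. -/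
noncomputable def altCoeff (p d : ℕ) : ℝ := (-1) ^ d * ((2 * p + 1 - 2 * d) / 2)

/-- Replacing `d` by `N - d` negates both `(-1) ^ d`, because `N` is odd, and `N - 2 d`. -/
theorem altCoeff_neg (p : ℕ) (d : Fin (2 * p + 1)) :
    altCoeff p (-d : Fin (2 * p + 1)).val = altCoeff p d.val := by
  by_cases hd : d = 0
  · simp [hd]
  · have hd' : d.val ≠ 0 := fun h => hd (Fin.ext h)
    have h1 : (-d : Fin (2 * p + 1)).val = 2 * p + 1 - d.val := by
      rw [Fin.val_neg', Nat.mod_eq_of_lt (by omega)]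
    obtain ⟨e, he⟩ : ∃ e, d.val + e = 2 * p + 1 := ⟨2 * p + 1 - d.val, by have := d.2; omega⟩
    have h2 : 2 * p + 1 - d.val = e := by omega
    have h3 : (-1 : ℝ) ^ d.val * (-1) ^ e = -1 := by
      rw [← pow_add, he]; exact Odd.neg_one_pow ⟨p, rfl⟩
    have h4 : ((-1 : ℝ) ^ d.val) ^ 2 = 1 := by rw [← pow_mul, mul_comm, pow_mul]; simp
    have h5 : (-1 : ℝ) ^ e = -(-1) ^ d.val := by
      linear_combination (-1 : ℝ) ^ d.val * h3 - (-1) ^ e * h4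
    have h6 : (d.val : ℝ) + e = 2 * p + 1 := by exact_mod_cast he
    rw [h1, h2, altCoeff, altCoeff, h5]
    linear_combination ((-1 : ℝ) ^ d.val) * h6

/-- Up to sign this is the second difference of the affine function `(N - 2 d) / 2`, hence zero away
from the kink at `d = 0`. -/
theorem altCoeff_recurrence (p : ℕ) (d : Fin (2 * p + 1)) :
    altCoeff p (d - 1).val + 2 * altCoeff p d.val + altCoeff p (d + 1).val =
      if d = 0 then 2 else 0 := by
  have hneg : ∀ d : Fin (2 * p + 1), d ≠ 0 →
      altCoeff p (d - 1).val + 2 * altCoeff p d.val + altCoeff p (d + 1).val = 0 := by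
    intro d hd
    obtain ⟨e, he⟩ : ∃ e, d.val = e + 1 :=
      Nat.exists_eq_succ_of_ne_zero (fun h => hd (Fin.ext h))
    -- Wrapping around is harmless: the formula takes the same value at `2 * p + 1` as at `0`.
    have h1 : altCoeff p (d + 1).val = altCoeff p (e + 2) := by
      rw [Fin.val_add_one]
      split_ifs with hl
      · have : e + 1 = 2 * p := by rw [← he, hl]; rfl
        rw [show e + 2 = 2 * p + 1 by omega]
        simp [altCoeff, pow_succ, pow_mul]
        ring
      · rw [he]
    rw [h1, Fin.coe_sub_one, if_neg hd, he, altCoeff, altCoeff, altCoeff]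
    simp only [Nat.add_sub_cancel, pow_succ]
    push_cast
    ring
  split_ifs with hd
  · subst hd
    by_cases hp : p = 0
    · subst hp
      simp [altCoeff]
      norm_num
    · have h1 : altCoeff p ((0 : Fin (2 * p + 1)) - 1).val = altCoeff p 1 := by
        rw [zero_sub, altCoeff_neg, Fin.val_one', Nat.mod_eq_of_lt (by omega)]
      rw [h1, zero_add, Fin.val_one', Nat.mod_eq_of_lt (by omega)]
      simp [altCoeff]
      ring
  · exact hneg d hd

/-- The vertex-edge incidence matrix of an odd cycle. -/
def cycleIncidence (p : ℕ) : Matrix (Fin (2 * p + 1)) (Fin (2 * p + 1)) ℝ :=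
  Matrix.of fun i j => (if i = j then 1 else 0) + (if i + 1 = j then 1 else 0)

/-- The signless Laplacian of an odd cycle. -/
def cycleSignless (p : ℕ) : Matrix (Fin (2 * p + 1)) (Fin (2 * p + 1)) ℝ :=
  (cycleIncidence p)ᵀ * cycleIncidence p

/-- Twice the inverse of the signless Laplacian of an odd cycle. -/
noncomputable def cycleAlt (p : ℕ) : Matrix (Fin (2 * p + 1)) (Fin (2 * p + 1)) ℝ :=
  Matrix.of fun i j => altCoeff p (j - i).val

/-- Separate indicators keep the formula valid for `p = 0`, where the three conditions coincide. -/
theorem cycleSignless_apply (p : ℕ) (i j : Fin (2 * p + 1)) :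
    cycleSignless p i j = 2 * (if i = j then 1 else 0) + (if i = j - 1 then 1 else 0)
      + (if i = j + 1 then 1 else 0) := by
  have h1 : ∀ k : Fin (2 * p + 1), k + 1 = i ↔ k = i - 1 := fun k => eq_sub_iff_add_eq.symm
  have h2 : i - 1 = j ↔ i = j + 1 := sub_eq_iff_eq_add
  have h3 : i + 1 = j ↔ i = j - 1 := eq_sub_iff_add_eq.symm
  simp only [cycleSignless, cycleIncidence, mul_apply, transpose_apply, of_apply, add_mul,
    ite_mul, one_mul, zero_mul, Finset.sum_add_distrib, h1, Finset.sum_ite_eq', Finset.mem_univ,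
    if_true, sub_add_cancel, h2, h3]
  ring

theorem cycleSignless_transpose (p : ℕ) : (cycleSignless p)ᵀ = cycleSignless p := by
  simp [cycleSignless, transpose_mul]

theorem cycleAlt_transpose (p : ℕ) : (cycleAlt p)ᵀ = cycleAlt p := by
  ext i j
  rw [transpose_apply, cycleAlt, of_apply, of_apply, ← altCoeff_neg, neg_sub]

theorem cycleAlt_mul_cycleSignless (p : ℕ) : cycleAlt p * cycleSignless p = (2 : ℝ) • 1 := by
  ext i j
  have h := altCoeff_recurrence p (j - i)
  have h1 : j - i - 1 = j - 1 - i := by abel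
  have h2 : j - i + 1 = j + 1 - i := by abel
  rw [h1, h2] at h
  simp only [mul_apply, cycleSignless_apply, mul_add, mul_ite, mul_one, mul_zero,
    Finset.sum_add_distrib, Finset.sum_ite_eq', Finset.mem_univ, if_true]
  simp only [cycleAlt, of_apply, Matrix.smul_apply, one_apply, sub_eq_zero, eq_comm (a := j)] at h ⊢
  simp only [smul_eq_mul, mul_ite, mul_one, mul_zero]
  rw [← h]
  ring

theorem sum_cycleSignless (p : ℕ) (j : Fin (2 * p + 1)) : ∑ i, cycleSignless p i j = 4 := by
  simp only [cycleSignless_apply, Finset.sum_add_distrib, ← Finset.mul_sum, Finset.sum_ite_eq',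
    Finset.mem_univ, if_true]
  norm_num

theorem cycleSignless_mulVec_one (p : ℕ) : cycleSignless p *ᵥ 1 = (4 : ℝ) • 1 := by
  ext i
  rw [← cycleSignless_transpose]
  simpa [mulVec, dotProduct] using sum_cycleSignless p i

theorem cycleSignless_mul_cycleAlt (p : ℕ) : cycleSignless p * cycleAlt p = (2 : ℝ) • 1 := by
  have := congrArg transpose (cycleAlt_mul_cycleSignless p)
  simpa [transpose_mul, cycleAlt_transpose, cycleSignless_transpose] using this

theorem cycleAlt_mulVec_one (p : ℕ) : cycleAlt p *ᵥ 1 = (1 / 2 : ℝ) • 1 := by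
  have h := congrArg (cycleAlt p *ᵥ ·) (cycleSignless_mulVec_one p)
  simp only [mulVec_mulVec, cycleAlt_mul_cycleSignless, mulVec_smul, smul_mulVec,
    one_mulVec] at h
  have h2 := congrArg ((1 / 4 : ℝ) • ·) h
  simp only [smul_smul] at h2
  norm_num at h2 ⊢
  exact h2.symm

theorem sum_cycleAlt (p : ℕ) (i : Fin (2 * p + 1)) : ∑ j, cycleAlt p i j = 1 / 2 := by
  simpa [mulVec, dotProduct] using congrFun (cycleAlt_mulVec_one p) i

/-- With `w = A x` one has `x = S w / 2`, and `S = Bᵀ B` for the incidence matrix `B`. -/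
theorem dotProduct_cycleAlt_mulVec (p : ℕ) (x : Fin (2 * p + 1) → ℝ) :
    x ⬝ᵥ cycleAlt p *ᵥ x = (1 / 2) * ((cycleIncidence p *ᵥ cycleAlt p *ᵥ x) ⬝ᵥ
      (cycleIncidence p *ᵥ cycleAlt p *ᵥ x)) := by
  have h : (cycleIncidence p *ᵥ cycleAlt p *ᵥ x) ⬝ᵥ (cycleIncidence p *ᵥ cycleAlt p *ᵥ x)
      = (cycleAlt p *ᵥ x) ⬝ᵥ (cycleSignless p *ᵥ cycleAlt p *ᵥ x) := by
    rw [dotProduct_mulVec, ← mulVec_transpose, mulVec_mulVec, cycleSignless, dotProduct_comm]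
  rw [h, mulVec_mulVec x, cycleSignless_mul_cycleAlt, smul_mulVec, one_mulVec, dotProduct_smul,
    dotProduct_comm, smul_eq_mul]
  ring

theorem dotProduct_cycleAlt_mulVec_nonneg (p : ℕ) (x : Fin (2 * p + 1) → ℝ) :
    0 ≤ x ⬝ᵥ cycleAlt p *ᵥ x := by
  rw [dotProduct_cycleAlt_mulVec]
  exact mul_nonneg (by norm_num) (Finset.sum_nonneg fun i _ => mul_self_nonneg _)

theorem eq_zero_of_dotProduct_cycleAlt_mulVec (p : ℕ) (x : Fin (2 * p + 1) → ℝ)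
    (h : x ⬝ᵥ cycleAlt p *ᵥ x = 0) : x = 0 := by
  rw [dotProduct_cycleAlt_mulVec] at h
  have h1 := dotProduct_self_eq_zero.1 ((mul_eq_zero.1 h).resolve_left (by norm_num))
  have h2 : (cycleSignless p * cycleAlt p) *ᵥ x = 0 := by
    rw [cycleSignless, ← mulVec_mulVec, ← mulVec_mulVec, h1, mulVec_zero]
  rw [cycleSignless_mul_cycleAlt, smul_mulVec, one_mulVec] at h2
  exact (smul_eq_zero.1 h2).resolve_left (by norm_num)

/-! ### Entries of `D` and `L` in terms of the cycle matrices. -/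

theorem helmCycleDist_eq_sub (p : ℕ) (hp : 1 ≤ p) (i j : Fin (2 * p + 1)) :
    (helmCycleDist (2 * p + 1) i j : ℝ) = 2 - cycleSignless p i j := by
  have h1 : (1 : Fin (2 * p + 1)).val = 1 := by
    rw [Fin.val_one', Nat.mod_eq_of_lt (by omega)]
  have hadj : (SimpleGraph.cycleGraph (2 * p + 1)).Adj i j ↔ i = j + 1 ∨ i = j - 1 := by
    have h2 : ∀ a : Fin (2 * p + 1), a.val = 1 ↔ a = 1 := fun a => by
      rw [Fin.ext_iff, h1]
    rw [SimpleGraph.cycleGraph_adj', h2, h2, sub_eq_iff_eq_add, sub_eq_iff_eq_add,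
      eq_sub_iff_add_eq, eq_comm (a := j), add_comm j, add_comm i]
  have hne : (1 : Fin (2 * p + 1)) ≠ 0 := fun h => by
    have := congrArg Fin.val h; rw [h1] at this; simp at this
  have hne2 : (1 : Fin (2 * p + 1)) + 1 ≠ 0 := fun h => by
    have := congrArg Fin.val h
    rw [Fin.val_add, h1, Nat.mod_eq_of_lt (by omega)] at this; simp at this
  have h3 : ¬ (i = j + 1 ∧ i = j - 1) := by
    rintro ⟨h, h'⟩
    rw [h, eq_sub_iff_add_eq, add_assoc] at h'
    exact hne2 (add_eq_left.1 h')
  have h4 : ¬ (i = j ∧ i = j + 1) := by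
    rintro ⟨h, h'⟩
    rw [h] at h'
    exact hne (add_eq_left.1 h'.symm)
  have h5 : ¬ (i = j ∧ i = j - 1) := by
    rintro ⟨h, h'⟩
    rw [h, eq_sub_iff_add_eq] at h'
    exact hne (add_eq_left.1 h')
  have h6 : helmCycleDist (2 * p + 1) i j
      = if i = j then 0 else if i = j + 1 ∨ i = j - 1 then 1 else 2 := by
    simp only [← hadj]
    rfl
  rw [h6, cycleSignless_apply]
  by_cases ha : i = j
  · have hb : ¬ i = j + 1 := fun h => h4 ⟨ha, h⟩
    have hc : ¬ i = j - 1 := fun h => h5 ⟨ha, h⟩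
    rw [if_pos ha, if_pos ha, if_neg hb, if_neg hc]
    norm_num
  · rw [if_neg ha, if_neg ha]
    by_cases hb : i = j + 1
    · have hc : ¬ i = j - 1 := fun h => h3 ⟨hb, h⟩
      rw [if_pos (Or.inl hb), if_pos hb, if_neg hc]
      norm_num
    · by_cases hc : i = j - 1
      · rw [if_pos (Or.inr hc), if_neg hb, if_pos hc]
        norm_num
      · rw [if_neg (not_or.2 ⟨hb, hc⟩), if_neg hb, if_neg hc]
        norm_num

/-- The distance matrix of a helm graph in terms of the signless Laplacian of its cycle. -/
noncomputable def helmDistBlock (p : ℕ) : HelmVertex (2 * p + 2) → HelmVertex (2 * p + 2) → ℝ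
  | .inl _, .inl _ => 0
  | .inl _, .inr (.inl _) => 1
  | .inl _, .inr (.inr _) => 2
  | .inr (.inl _), .inl _ => 1
  | .inr (.inr _), .inl _ => 2
  | .inr (.inl i), .inr (.inl j) => 2 - cycleSignless p i j
  | .inr (.inl i), .inr (.inr j) => 3 - cycleSignless p i j
  | .inr (.inr i), .inr (.inl j) => 3 - cycleSignless p i j
  | .inr (.inr i), .inr (.inr j) => 4 - cycleSignless p i j - 2 * (1 : Matrix _ _ ℝ) i j

/-- The term `-2 I` in the pendant block corrects the diagonal, where the two stem edges must not be
counted. -/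
theorem helmDist_apply (p : ℕ) (hp : 1 ≤ p) (v w : HelmVertex (2 * p + 2)) :
    helmDist (2 * p + 2) v w = helmDistBlock p v w := by
  rw [helmDist, of_apply, helmGraph_dist]
  rcases v with _ | i | i <;> rcases w with _ | j | j <;>
    simp only [helmDistFun, helmDistBlock, Nat.cast_zero, Nat.cast_one, Nat.cast_ofNat]
  · exact helmCycleDist_eq_sub p hp i j
  · have : (helmCycleDist (2 * p + 2 - 1) i j : ℝ) = 2 - cycleSignless p i j :=
      helmCycleDist_eq_sub p hp i j
    push_cast
    linarith
  · have : (helmCycleDist (2 * p + 2 - 1) i j : ℝ) = 2 - cycleSignless p i j :=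
      helmCycleDist_eq_sub p hp i j
    push_cast
    linarith
  · have : (helmCycleDist (2 * p + 2 - 1) i j : ℝ) = 2 - cycleSignless p i j :=
      helmCycleDist_eq_sub p hp i j
    by_cases h : i = j
    · subst h
      have h0 := (helmCycleDist_eq_zero (2 * p + 1) i i).2 rfl
      have h1 : (1 : Matrix (Fin (2 * p + 1)) (Fin (2 * p + 1)) ℝ) i i = 1 := one_apply_eq i
      rw [if_pos rfl, h1]
      change ((helmCycleDist (2 * p + 1) i i : ℕ) : ℝ) = _ at this
      rw [h0] at this
      push_cast at this ⊢
      linarith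
    · have h1 : (1 : Matrix (Fin (2 * p + 1)) (Fin (2 * p + 1)) ℝ) i j = 0 := one_apply_ne h
      rw [if_neg h]
      simp only [h1]
      push_cast
      linarith

/-- The special Laplacian matrix of a helm graph, entrywise. -/
noncomputable def helmLaplacianBlock (p : ℕ) :
    HelmVertex (2 * p + 2) → HelmVertex (2 * p + 2) → ℝ
  | .inl _, .inl _ => (2 * p + 1) / 2
  | .inl _, .inr (.inl _) => -1 / 2
  | .inl _, .inr (.inr _) => 0
  | .inr (.inl _), .inl _ => -1 / 2
  | .inr (.inr _), .inl _ => 0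
  | .inr (.inl i), .inr (.inl j) => (1 : Matrix _ _ ℝ) i j + cycleAlt p i j
  | .inr (.inl i), .inr (.inr j) => -(1 : Matrix _ _ ℝ) i j
  | .inr (.inr i), .inr (.inl j) => -(1 : Matrix _ _ ℝ) i j
  | .inr (.inr i), .inr (.inr j) => (1 : Matrix _ _ ℝ) i j

/-- Each nonzero offset is `k` or `N - k` for exactly one `k` in `1, …, p`. The diagonal `p + 1 / 2`
is `altCoeff p 0`, and `(n + 1) / 2` exceeds it by the `1` of `I + A`. -/
theorem sum_altCoeff_circ (p : ℕ) (i j : Fin (2 * p + 1)) :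
    (p + 1 / 2 : ℝ) * (1 : Matrix _ _ ℝ) i j + ∑ k ∈ Finset.Icc 1 p,
      altCoeff p k * (if (j - i).val = k ∨ (j - i).val + k = 2 * p + 1 then 1 else 0)
      = cycleAlt p i j := by
  rw [cycleAlt, of_apply]
  by_cases hij : i = j
  · subst hij
    rw [Finset.sum_eq_zero]
    · simp [altCoeff]
      ring
    · intro k hk
      rw [Finset.mem_Icc] at hk
      rw [if_neg, mul_zero]
      simp
      omega
  · have hd : (j - i).val ≠ 0 := fun h => hij (sub_eq_zero.1 (Fin.ext h)).symm
    have hlt := (j - i).2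
    rw [one_apply_ne hij, mul_zero, zero_add]
    by_cases hle : (j - i).val ≤ p
    · rw [Finset.sum_eq_single_of_mem (j - i).val (by simp; omega)]
      · simp
      · intro k hk hk'
        rw [Finset.mem_Icc] at hk
        rw [if_neg (by omega), mul_zero]
    · have hneg : (i - j).val = 2 * p + 1 - (j - i).val := by
        rw [← neg_sub, Fin.val_neg', Nat.mod_eq_of_lt (by omega)]
      rw [← altCoeff_neg, neg_sub]
      rw [Finset.sum_eq_single_of_mem (i - j).val (by simp; omega)]
      · rw [if_pos (by omega), mul_one]
      · intro k hk hk'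
        rw [Finset.mem_Icc] at hk
        rw [if_neg (by omega), mul_zero]

theorem helmLaplacian_apply (p : ℕ) (v w : HelmVertex (2 * p + 2)) :
    helmLaplacian (2 * p + 2) v w = helmLaplacianBlock p v w := by
  have hp : (2 * p + 2) / 2 - 1 = p := by omega
  rw [helmLaplacian, hp, Matrix.add_apply, Matrix.smul_apply, Matrix.sum_apply]
  rcases v with _ | i | i <;> rcases w with _ | j | j <;>
    simp [helmLaplacianBlock]
  · ring
  · ring
  · ring
  · rw [← sum_altCoeff_circ]
    have h : ∀ k ∈ Finset.Icc 1 p,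
        (-1 : ℝ) ^ k * ((2 * p + 2 - 1 - 2 * k) / 2) * circ (cVec (2 * p + 2) k) i j
        = altCoeff p k * (if (j - i).val = k ∨ (j - i).val + k = 2 * p + 1 then 1 else 0) := by
      intro k hk
      rw [Finset.mem_Icc] at hk
      rw [circ, of_apply, cVec, altCoeff]
      congr 1
      · ring
      · refine if_congr ?_ rfl rfl
        omega
    rw [Finset.sum_congr rfl h]
    ring

/-! ### The products `yᵀ D` and `L D`. -/

/-- The vector whose square is the rank-one part of the inverse of the distance matrix. -/
noncomputable def helmVec (p : ℕ) : HelmVertex (2 * p + 2) → ℝ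
  | .inl _ => (3 - 2 * p) / 2
  | .inr (.inl _) => -1 / 2
  | .inr (.inr _) => 1

theorem sum_cycleAlt_mul_cycleSignless (p : ℕ) (i j : Fin (2 * p + 1)) :
    ∑ k, cycleAlt p i k * cycleSignless p k j = 2 * (1 : Matrix _ _ ℝ) i j := by
  simpa [mul_apply] using congrFun (congrFun (cycleAlt_mul_cycleSignless p) i) j

theorem sum_helmVec_mul_helmDistBlock (p : ℕ) (w : HelmVertex (2 * p + 2)) :
    ∑ v, helmVec p v * helmDistBlock p v w = 3 * (2 * p + 1) / 2 := by
  have hcol : ∀ (j : Fin (2 * p + 1)),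
    ∑ i, (1 : Matrix (Fin (2 * p + 1)) (Fin (2 * p + 1)) ℝ) i j = 1 := by
    simp [one_apply]
  rw [Fintype.sum_sum_type, Fintype.sum_sum_type, Fintype.sum_unique]
  rcases w with _ | j | j
  · simp [helmVec, helmDistBlock]
    ring
  · have := sum_cycleSignless p j
    simp only [helmVec, helmDistBlock]
    -- The index type is `Fin (2 * p + 2 - 1)`, definitionally `Fin (2 * p + 1)`; the cycle lemmas
    -- need the latter form.
    change _ + (∑ i : Fin (2 * p + 1), _ + ∑ i : Fin (2 * p + 1), _) = _
    simp only [mul_sub, Finset.sum_sub_distrib, ← Finset.mul_sum, this]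
    simp
    ring
  · have := sum_cycleSignless p j
    simp only [helmVec, helmDistBlock]
    change _ + (∑ i : Fin (2 * p + 1), _ + ∑ i : Fin (2 * p + 1), _) = _
    simp only [mul_sub, Finset.sum_sub_distrib, ← Finset.mul_sum, this, hcol]
    simp
    ring

/-- This identity dictates `helmVec`: all columns of `L D + 2 I` are equal to it. The inputs are `A
S = 2 I` and the constant row and column sums. -/
theorem sum_helmLaplacianBlock_mul_helmDistBlock (p : ℕ) (v w : HelmVertex (2 * p + 2)) :
    ∑ u, helmLaplacianBlock p v u * helmDistBlock p u w
      = helmVec p v - 2 * (1 : Matrix _ _ ℝ) v w := by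
  have hcol : ∀ (j : Fin (2 * p + 1)),
    ∑ i, (1 : Matrix (Fin (2 * p + 1)) (Fin (2 * p + 1)) ℝ) i j = 1 := by
    simp [one_apply]
  have hmul : ∀ (f : Fin (2 * p + 1) → ℝ) (i : Fin (2 * p + 1)),
    ∑ j, (1 : Matrix (Fin (2 * p + 1)) (Fin (2 * p + 1)) ℝ) i j * f j = f i := by
    simp [one_apply]
  rw [Fintype.sum_sum_type, Fintype.sum_sum_type, Fintype.sum_unique]
  rcases v with _ | i | i <;> rcases w with _ | j | j <;>
    simp only [helmVec, helmDistBlock, helmLaplacianBlock] <;>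
    change _ + (∑ i : Fin (2 * p + 1), _ + ∑ i : Fin (2 * p + 1), _) = _ <;>
    simp only [add_mul, mul_sub, neg_mul, Finset.sum_sub_distrib, Finset.sum_add_distrib,
      Finset.sum_neg_distrib, ← Finset.sum_mul, ← Finset.mul_sum,
      sum_cycleSignless, sum_cycleAlt, sum_cycleAlt_mul_cycleSignless, hcol, hmul] <;>
    simp [one_apply]
  all_goals ring

/-! ### Symmetry, positivity and kernel of `L`. -/

theorem helmLaplacian_mulVec_hub (p : ℕ) (x : HelmVertex (2 * p + 2) → ℝ) :
    (helmLaplacian (2 * p + 2) *ᵥ x) (.inl ()) =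
      (2 * p + 1) / 2 * x (.inl ()) - 1 / 2 * ∑ i : Fin (2 * p + 1), x (.inr (.inl i)) := by
  rw [mulVec, dotProduct, Fintype.sum_sum_type, Fintype.sum_sum_type, Fintype.sum_unique]
  simp only [helmLaplacian_apply, helmLaplacianBlock]
  change _ + (∑ i : Fin (2 * p + 1), _ + ∑ i : Fin (2 * p + 1), _) = _
  simp only [← Finset.mul_sum]
  simp
  ring

theorem helmLaplacian_mulVec_cycle (p : ℕ) (x : HelmVertex (2 * p + 2) → ℝ)
    (i : Fin (2 * p + 1)) :
    (helmLaplacian (2 * p + 2) *ᵥ x) (.inr (.inl i)) =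
      -1 / 2 * x (.inl ()) + x (.inr (.inl i))
        + (cycleAlt p *ᵥ fun j : Fin (2 * p + 1) => x (.inr (.inl j))) i - x (.inr (.inr i)) := by
  rw [mulVec, dotProduct, Fintype.sum_sum_type, Fintype.sum_sum_type, Fintype.sum_unique]
  simp only [helmLaplacian_apply, helmLaplacianBlock]
  change _ + (∑ i : Fin (2 * p + 1), _ + ∑ i : Fin (2 * p + 1), _) = _
  simp only [add_mul, neg_mul, Finset.sum_add_distrib, Finset.sum_neg_distrib]
  simp [one_apply, mulVec, dotProduct]
  ring

theorem helmLaplacian_mulVec_pendant (p : ℕ) (x : HelmVertex (2 * p + 2) → ℝ)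
    (i : Fin (2 * p + 1)) :
    (helmLaplacian (2 * p + 2) *ᵥ x) (.inr (.inr i)) =
      x (.inr (.inr i)) - x (.inr (.inl i)) := by
  rw [mulVec, dotProduct, Fintype.sum_sum_type, Fintype.sum_sum_type, Fintype.sum_unique]
  simp only [helmLaplacian_apply, helmLaplacianBlock]
  change _ + (∑ i : Fin (2 * p + 1), _ + ∑ i : Fin (2 * p + 1), _) = _
  simp [one_apply]
  ring

theorem helmLaplacian_isSymm (p : ℕ) : (helmLaplacian (2 * p + 2)).IsSymm := by
  ext v w
  have h1 : ∀ i j : Fin (2 * p + 1), (1 : Matrix _ _ ℝ) j i = (1 : Matrix _ _ ℝ) i j := by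
    intro i j
    rw [one_apply, one_apply]
    exact if_congr eq_comm rfl rfl
  have h2 : ∀ i j, cycleAlt p j i = cycleAlt p i j :=
    fun i j => congrFun (congrFun (cycleAlt_transpose p) i) j
  rw [transpose_apply, helmLaplacian_apply, helmLaplacian_apply]
  rcases v with _ | i | i <;> rcases w with _ | j | j <;> simp only [helmLaplacianBlock]
  · rw [h1, h2]
  · rw [h1]
  · rw [h1]
  · rw [h1]

/-- Completing the square: since `A 1 = 1 / 2`, the shift of the cycle values by the hub value
produces exactly the hub terms of `L`. -/
theorem helmLaplacian_quadratic (p : ℕ) (x : HelmVertex (2 * p + 2) → ℝ) :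
    x ⬝ᵥ helmLaplacian (2 * p + 2) *ᵥ x =
      (fun i : Fin (2 * p + 1) => x (.inr (.inl i)) - x (.inl ())) ⬝ᵥ
        (cycleAlt p *ᵥ fun i : Fin (2 * p + 1) => x (.inr (.inl i)) - x (.inl ()))
      + ∑ i : Fin (2 * p + 1), (x (.inr (.inl i)) - x (.inr (.inr i))) ^ 2 := by
  set h := x (.inl ()) with hh
  set u : Fin (2 * p + 1) → ℝ := fun i => x (.inr (.inl i)) with hu
  have hz : (fun i : Fin (2 * p + 1) => x (.inr (.inl i)) - h) = u - h • 1 := by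
    ext i; simp [hu]
  have h1 : (1 : Fin (2 * p + 1) → ℝ) ⬝ᵥ cycleAlt p *ᵥ u = 1 / 2 * ∑ i, u i := by
    rw [dotProduct_mulVec, ← mulVec_transpose, cycleAlt_transpose, cycleAlt_mulVec_one,
      smul_dotProduct, one_dotProduct, smul_eq_mul]
  rw [hz, mulVec_sub, mulVec_smul, cycleAlt_mulVec_one, sub_dotProduct, dotProduct_sub,
    dotProduct_sub, smul_dotProduct, smul_dotProduct, h1]
  rw [dotProduct, Fintype.sum_sum_type, Fintype.sum_sum_type, Fintype.sum_unique]
  change _ + (∑ i : Fin (2 * p + 1), _ + ∑ i : Fin (2 * p + 1), _) = _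
  rw [show (default : Unit) = () from rfl, helmLaplacian_mulVec_hub]
  simp only [helmLaplacian_mulVec_cycle, helmLaplacian_mulVec_pendant]
  rw [← Finset.sum_add_distrib]
  have h2 : ∀ i : Fin (2 * p + 1),
      x (.inr (.inl i)) * (-1 / 2 * x (.inl ()) + x (.inr (.inl i)) + (cycleAlt p *ᵥ u) i
        - x (.inr (.inr i))) + x (.inr (.inr i)) * (x (.inr (.inr i)) - x (.inr (.inl i)))
      = -1 / 2 * h * u i + u i * (cycleAlt p *ᵥ u) i
        + (x (.inr (.inl i)) - x (.inr (.inr i))) ^ 2 := by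
    intro i
    simp only [hu, hh]
    ring
  rw [Finset.sum_congr rfl fun i _ => h2 i, Finset.sum_add_distrib, Finset.sum_add_distrib,
    ← Finset.mul_sum]
  have h3 : ∑ i, (1 : Fin (2 * p + 1) → ℝ) i = 2 * p + 1 := by simp
  simp only [dotProduct_smul, dotProduct_one, smul_eq_mul, h3]
  simp only [dotProduct, hu, ← hh]
  ring

theorem helmLaplacian_nonneg (p : ℕ) (x : HelmVertex (2 * p + 2) → ℝ) :
    0 ≤ x ⬝ᵥ helmLaplacian (2 * p + 2) *ᵥ x := by
  rw [helmLaplacian_quadratic]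
  exact add_nonneg (dotProduct_cycleAlt_mulVec_nonneg p _)
    (Finset.sum_nonneg fun i _ => sq_nonneg _)

theorem eq_zero_of_helmLaplacian_quadratic (p : ℕ) (x : HelmVertex (2 * p + 2) → ℝ)
    (h : x ⬝ᵥ helmLaplacian (2 * p + 2) *ᵥ x = 0) (h0 : x (.inl ()) = 0) : x = 0 := by
  rw [helmLaplacian_quadratic] at h
  have h1 := dotProduct_cycleAlt_mulVec_nonneg p (fun i : Fin (2 * p + 1) => x (.inr (.inl i)) - x (.inl ()))
  have h2 : 0 ≤ ∑ i : Fin (2 * p + 1), (x (.inr (.inl i)) - x (.inr (.inr i))) ^ 2 :=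
    Finset.sum_nonneg fun i _ => sq_nonneg _
  have h3 := eq_zero_of_dotProduct_cycleAlt_mulVec p _ (le_antisymm (by linarith) h1)
  have h4 := (Finset.sum_eq_zero_iff_of_nonneg fun i _ => sq_nonneg _).1
    (le_antisymm (by linarith) h2)
  have h5 : ∀ i : Fin (2 * p + 1), x (.inr (.inl i)) = 0 := fun i => by
    have := congrFun h3 i
    simpa [h0] using this
  ext v
  rcases v with _ | i | i
  · exact h0
  · exact h5 i
  · have := pow_eq_zero_iff (two_ne_zero) |>.1 (h4 i (Finset.mem_univ _))
    rw [h5 i] at this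
    simpa using this

theorem helmLaplacian_mulVec_one (p : ℕ) : helmLaplacian (2 * p + 2) *ᵥ 1 = 0 := by
  ext v
  rcases v with _ | i | i
  · rw [helmLaplacian_mulVec_hub]
    simp
    ring
  · rw [helmLaplacian_mulVec_cycle]
    have h : (fun j : Fin (2 * p + 1) => (1 : HelmVertex (2 * p + 2) → ℝ) (.inr (.inl j))) = 1 :=
      rfl
    rw [h, cycleAlt_mulVec_one]
    simp
    norm_num
  · rw [helmLaplacian_mulVec_pendant]
    simp

/-! ### The inverse of `D` and the conclusion. -/

/-- With `L D = y 1ᵀ - 2 I` and `yᵀ D = (3N/2) 1ᵀ`, the multiples of `y 1ᵀ` cancel precisely for the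
coefficient `1/(3N)`. -/
theorem helm_inverse_mul_helmDist (p : ℕ) (hp : 1 ≤ p) :
    (-(1 / 2 : ℝ) • helmLaplacian (2 * p + 2)
      + (1 / (3 * (2 * p + 1)) : ℝ) • vecMulVec (helmVec p) (helmVec p))
      * helmDist (2 * p + 2) = 1 := by
  ext v w
  have h1 := sum_helmLaplacianBlock_mul_helmDistBlock p v w
  have h2 := sum_helmVec_mul_helmDistBlock p w
  rw [mul_apply]
  have h3 : ∀ u, (-(1 / 2 : ℝ) • helmLaplacian (2 * p + 2)
      + (1 / (3 * (2 * p + 1)) : ℝ) • vecMulVec (helmVec p) (helmVec p)) v u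
      * helmDist (2 * p + 2) u w
      = -(1 / 2) * (helmLaplacianBlock p v u * helmDistBlock p u w)
        + 1 / (3 * (2 * p + 1)) * helmVec p v * (helmVec p u * helmDistBlock p u w) := by
    intro u
    rw [helmDist_apply p hp, Matrix.add_apply, Matrix.smul_apply, Matrix.smul_apply,
      helmLaplacian_apply, vecMulVec_apply]
    simp only [smul_eq_mul]
    ring
  rw [Finset.sum_congr rfl fun u _ => h3 u, Finset.sum_add_distrib, ← Finset.mul_sum,
    ← Finset.mul_sum, h1, h2]
  have h4 : (2 * p + 1 : ℝ) ≠ 0 := by positivity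
  field_simp
  ring

theorem exists_helmDist_quadratic_pos (p : ℕ) (hp : 1 ≤ p) :
    ∃ x, 0 < x ⬝ᵥ helmDist (2 * p + 2) *ᵥ x := by
  let c : HelmVertex (2 * p + 2) := .inr (.inl (0 : Fin (2 * p + 1)))
  -- For two adjacent vertices the zero diagonal leaves twice their distance, that is `2`.
  refine ⟨Pi.single (.inl ()) 1 + Pi.single c 1, ?_⟩
  have h1 : ∀ v, helmDist (2 * p + 2) v v = 0 := fun v => by simp [helmDist]
  have h2 : helmDist (2 * p + 2) (.inl ()) c = 1 := helmDist_apply p hp _ _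
  have h3 : helmDist (2 * p + 2) c (.inl ()) = 1 := helmDist_apply p hp _ _
  simp [mulVec_add, add_dotProduct, h1, h2, h3]

theorem mainTheorem6 (n : ℕ) (hn : 4 ≤ n) (hne : Even n) (m : ℕ) (hm : m = 2 * n - 1)
    (mu lam : ℕ → ℝ)
    (hmu : AntitoneOn mu (Set.Icc 1 m))
    (hmuD : (helmDist n).charpoly =
      ∏ i ∈ Finset.Icc 1 m, (Polynomial.X - Polynomial.C (mu i)))
    (hlam : AntitoneOn lam (Set.Icc 1 m))
    (hlamL : (helmLaplacian n).charpoly =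
      ∏ i ∈ Finset.Icc 1 m, (Polynomial.X - Polynomial.C (lam i))) :
    (0 < mu 1 ∧ mu 2 < 0) ∧
    (0 < lam (m - 1) ∧ lam m = 0) ∧
    -2 / lam 1 < 0 ∧
    (∀ k ∈ Finset.Icc 1 (m - 1), mu (k + 1) ≤ -2 / lam k) ∧
    (∀ k ∈ Finset.Icc 2 (m - 1), -2 / lam k ≤ mu k) := by
  -- Evenness of `n` enters here: the cycle has odd length `2 * p + 1`.
  obtain ⟨p, rfl⟩ : ∃ p, n = 2 * p + 2 := by
    obtain ⟨r, hr⟩ := hne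
    exact ⟨r - 1, by omega⟩
  have hp : 1 ≤ p := by omega
  refine interlacing_of_inverse_eq (helmDist (2 * p + 2)) (helmLaplacian (2 * p + 2)) (helmVec p)
    (1 / (3 * (2 * p + 1))) (by positivity) (.inl ()) ?_ (helmLaplacian_isSymm p)
    (helm_inverse_mul_helmDist p hp) (helmLaplacian_nonneg p)
    (eq_zero_of_helmLaplacian_quadratic p)
    ⟨1, one_ne_zero, helmLaplacian_mulVec_one p⟩ (exists_helmDist_quadratic_pos p hp)
    m (by omega) mu lam hmu hmuD hlam hlamL
  ext v w
  simp [helmDist, SimpleGraph.dist_comm]
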